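/- All quantum systems are finite-dimensional. A channel $\mathcal A$ (a completely positive trace-preserving linear map) is $\varepsilon$-QLDP if $\mathrm{Tr}[M\mathcal A(\omega)]\le e^{\varepsilon}\,\mathrm{Tr}[M\mathcal A(\tau)]$ for all input states $\omega,\tau$ and all operators $0\le M\le I$ on the output system. For states $\rho,\sigma$ and priors $p,q>0$ with $p+q=1$, let $$p_e(\rho,\sigma,p,q)=\min\{\,p\,\mathrm{Tr}[M_2\rho]+q\,\mathrm{Tr}[M_1\sigma] : M_1,M_2\ge 0,\ M_1+M_2=I\,\},$$ for a channel $\mathcal A$ let $$\mathrm{SC}^{\mathcal A}_{(\rho,\sigma)}(\alpha,p,q)=\min\{\,n\in\mathbb N : p_e(\mathcal A(\rho)^{\otimes n},\mathcal A(\sigma)^{\otimes n},p,q)\le\alpha\,\},$$ and let $\mathrm{SC}^{\varepsilon}_{(\rho,\sigma)}(\alpha,p,q)$ be the infimum of $\mathrm{SC}^{\mathcal A}_{(\rho,\sigma)}(\alpha,p,q)$ over all $\varepsilon$-QLDP channels $\mathcal A$ (with arbitrary finite-dimensional output system). For orthogonal states $\rho,\sigma$ and $\varepsilon>0$, let $\mathcal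 A_\varepsilon=\mathcal A^{t}_{\mathrm{Dep}}\circ\mathcal M$ be the measure-then-depolarize mechanism, where $\mathcal M(\omega)=\mathrm{Tr}[\Pi_+\omega]\,|0\rangle\langle 0|+\mathrm{Tr}[(I-\Pi_+)\omega]\,|1\rangle\langle 1|$, $\Pi_+$ is the orthogonal projection onto the positive eigenspace of $\rho-\sigma$, and $\mathcal A^{t}_{\mathrm{Dep}}(\omega)=(1-t)\,\omega+\tfrac t2 \mathrm{Tr}[\omega]\, I$ is the qubit depolarizing channel with $t=2/(e^{\varepsilon}+1)$. **Theorem.** Let $p,q>0$ with $p+q=1$ and let $0<\alpha\le pq$. There are constants $c,C>0$, depending only on $\alpha,p,q$, such that for all orthogonal states $\rho,\sigma$ (on a system of any finite dimension) and all $\varepsilon>0$: 1. $\mathrm{SC}^{\varepsilon}_{(\rho,\sigma)}(\alpha,p,q)$ is finite and $$c\left(\frac{e^\varepsilon+1}{e^\varepsilon-1}\right)^2\le \mathrm{SC}^{\varepsilon}_{(\rho,\sigma)}(\alpha,p,q)\le C\left(\frac{e^\varepsilon+1}{e^\varepsilon-1}\right)^2,$$ that is, $\mathrm{SC}^{\varepsilon}_{(\rho,\sigma)}=\Theta\big(\big(\tfrac{e^\varepsilon+1}{e^\varepsilon-1}\big)^2\big)$.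 2. If moreover $\varepsilon<1$, then $c/\varepsilon^2\le \mathrm{SC}^{\varepsilon}_{(\rho,\sigma)}(\alpha,p,q)\le C/\varepsilon^2$, that is, $\mathrm{SC}^{\varepsilon}_{(\rho,\sigma)}=\Theta(1/\varepsilon^2)$. 3. $\mathcal A_\varepsilon$ is an $\varepsilon$-QLDP channel and is order optimal: $\mathrm{SC}^{\mathcal A_\varepsilon}_{(\rho,\sigma)}(\alpha,p,q)$ is finite and at most $C\,\mathrm{SC}^{\varepsilon}_{(\rho,\sigma)}(\alpha,p,q)$. -/

import Mathlib

/-!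
# Private quantum hypothesis testing

Finite-dimensional quantum systems are modelled by complex matrices indexed by a finite type.
-/

open scoped ComplexOrder

noncomputable section

namespace QPriv

/-- A quantum state (density matrix): positive semi-definite with unit trace. -/
def IsState {d : Type*} [Fintype d] (ρ : Matrix d d ℂ) : Prop :=
  ρ.PosSemidef ∧ ρ.trace = 1

/-- An effect (measurement operator) `M` with `0 ≤ M ≤ I`. -/
def IsEffect {d : Type*} [Fintype d] [DecidableEq d] (M : Matrix d d ℂ) : Prop :=
  M.PosSemidef ∧ (1 - M).PosSemidef

/-- Two states are orthogonal if their supports are orthogonal, that is, `ρ σ = 0`. -/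
def Orthogonal {d : Type*} [Fintype d] (ρ σ : Matrix d d ℂ) : Prop :=
  ρ * σ = 0

/-- The map `id ⊗ A` on `k × k` block matrices: apply `A` to every block. -/
def ampliation {d e : Type*} (k : ℕ) (A : Matrix d d ℂ →ₗ[ℂ] Matrix e e ℂ)
    (X : Matrix (Fin k × d) (Fin k × d) ℂ) : Matrix (Fin k × e) (Fin k × e) ℂ :=
  Matrix.of fun x y => A (Matrix.of fun i j => X (x.1, i) (y.1, j)) x.2 y.2

/-- A quantum channel: a completely positive and trace-preserving linear map. -/
def IsChannel {d e : Type*} [Fintype d] [Fintype e]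
    (A : Matrix d d ℂ →ₗ[ℂ] Matrix e e ℂ) : Prop :=
  (∀ (k : ℕ) (X : Matrix (Fin k × d) (Fin k × d) ℂ),
      X.PosSemidef → (ampliation k A X).PosSemidef) ∧
    ∀ X : Matrix d d ℂ, (A X).trace = X.trace

/-- `ε`-quantum local differential privacy: `Tr[M A(ρ)] ≤ e^ε Tr[M A(σ)]` for all states `ρ`, `σ`
and all measurement operators `0 ≤ M ≤ I`. -/
def IsQLDP {d e : Type*} [Fintype d] [Fintype e] [DecidableEq e] (ε : ℝ)
    (A : Matrix d d ℂ →ₗ[ℂ] Matrix e e ℂ) : Prop :=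
  ∀ ρ σ : Matrix d d ℂ, IsState ρ → IsState σ → ∀ M : Matrix e e ℂ, IsEffect M →
    ((M * A ρ).trace).re ≤ Real.exp ε * ((M * A σ).trace).re

/-- The `n`-fold tensor power `ρ^{⊗ n}`. -/
def tensorPower {d : Type*} (ρ : Matrix d d ℂ) (n : ℕ) :
    Matrix (Fin n → d) (Fin n → d) ℂ :=
  Matrix.of fun x y => ∏ i, ρ (x i) (y i)

/-- The optimal error probability of symmetric hypothesis testing between `ρ` (prior `p`) and
`σ` (prior `q`): the infimum of `p Tr[M₂ ρ] + q Tr[M₁ σ]` over two-outcome measurements. -/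
def errorProb {d : Type*} [Fintype d] [DecidableEq d] (ρ σ : Matrix d d ℂ) (p q : ℝ) : ℝ :=
  sInf {r : ℝ | ∃ M₁ M₂ : Matrix d d ℂ, M₁.PosSemidef ∧ M₂.PosSemidef ∧ M₁ + M₂ = 1 ∧
    r = p * ((M₂ * ρ).trace).re + q * ((M₁ * σ).trace).re}

/-- The sample complexity of distinguishing `ρ` and `σ`: the least `n` such that the optimal error
probability for `ρ^{⊗ n}` and `σ^{⊗ n}` is at most `α` (it is `⊤` if there is no such `n`). -/
def sampleComplexity {d : Type*} [Fintype d] [DecidableEq d] (ρ σ : Matrix d d ℂ)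
    (α p q : ℝ) : ℕ∞ :=
  ⨅ (n : ℕ) (_ : errorProb (tensorPower ρ n) (tensorPower σ n) p q ≤ α), (n : ℕ∞)

/-- The sample complexity of distinguishing `ρ` and `σ` under `ε`-QLDP: the infimum, over all
`ε`-QLDP channels `A` with an output system of any finite dimension, of the sample complexity of
distinguishing `A ρ` and `A σ`. -/
def privateSampleComplexity {d : Type*} [Fintype d] (ε : ℝ) (ρ σ : Matrix d d ℂ)
    (α p q : ℝ) : ℕ∞ :=
  ⨅ (m : ℕ) (A : Matrix d d ℂ →ₗ[ℂ] Matrix (Fin m) (Fin m) ℂ)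
    (_ : IsChannel A) (_ : IsQLDP ε A), sampleComplexity (A ρ) (A σ) α p q

/-- The depolarizing channel `X ↦ (1 - t) X + (t / d) Tr[X] I`. -/
def depolarizing (d : Type*) [Fintype d] [DecidableEq d] (t : ℝ) :
    Matrix d d ℂ →ₗ[ℂ] Matrix d d ℂ :=
  ((1 - t : ℝ) : ℂ) • LinearMap.id +
    ((t / Fintype.card d : ℝ) : ℂ) • (Matrix.traceLinearMap d ℂ ℂ).smulRight 1

/-- The measurement channel `X ↦ Tr[M X] |0⟩⟨0| + Tr[(I - M) X] |1⟩⟨1|`. -/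
def measurementChannel {d : Type*} [Fintype d] [DecidableEq d] (M : Matrix d d ℂ) :
    Matrix d d ℂ →ₗ[ℂ] Matrix (Fin 2) (Fin 2) ℂ where
  toFun X := Matrix.diagonal ![(M * X).trace, ((1 - M) * X).trace]
  map_add' X Y := by
    rw [Matrix.diagonal_add]
    congr 1
    ext i
    fin_cases i <;> simp [mul_add]
  map_smul' c X := by
    rw [RingHom.id_apply, ← Matrix.diagonal_smul]
    congr 1
    ext i
    fin_cases i <;> simp

/-- The orthogonal projection onto the positive eigenspace of a Hermitian matrix. -/
def posEigenProj {d : Type*} [Fintype d] [DecidableEq d] (X : Matrix d d ℂ) : Matrix d d ℂ :=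
  cfc (fun x : ℝ => if 0 < x then (1 : ℝ) else 0) X

/-- The measure-then-depolarize mechanism for the pair `ρ`, `σ` at privacy level `ε`: measure with
the projection onto the positive eigenspace of `ρ - σ`, then apply the qubit depolarizing channel
with parameter `2 / (e^ε + 1)`. -/
def measureDepolarize {d : Type*} [Fintype d] [DecidableEq d] (ε : ℝ) (ρ σ : Matrix d d ℂ) :
    Matrix d d ℂ →ₗ[ℂ] Matrix (Fin 2) (Fin 2) ℂ :=
  depolarizing (Fin 2) (2 / (Real.exp ε + 1)) ∘ₗ measurementChannel (posEigenProj (ρ - σ))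

end QPriv

end

noncomputable section

namespace QPriv

open Matrix Filter Topology
open scoped MatrixOrder

section Spectral

variable {d : Type*} [Fintype d] [DecidableEq d]

theorem PosSemidef.exists_conjTranspose_mul_self {A : Matrix d d ℂ} (hA : A.PosSemidef) :
    ∃ B : Matrix d d ℂ, A = Bᴴ * B := by
  obtain ⟨B, hB⟩ := CStarAlgebra.nonneg_iff_eq_star_mul_self.1 (nonneg_iff_posSemidef.2 hA)
  exact ⟨B, hB⟩

/-- The trace of a product of two positive semi-definite matrices is nonnegative. -/
theorem PosSemidef.trace_mul_nonneg_complex {A B : Matrix d d ℂ} (hA : A.PosSemidef)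
    (hB : B.PosSemidef) : 0 ≤ (A * B).trace := by
  obtain ⟨C, rfl⟩ := PosSemidef.exists_conjTranspose_mul_self hA
  rw [Matrix.mul_assoc, trace_mul_comm]
  exact (hB.mul_mul_conjTranspose_same C).trace_nonneg

theorem PosSemidef.trace_mul_nonneg {A B : Matrix d d ℂ} (hA : A.PosSemidef)
    (hB : B.PosSemidef) : 0 ≤ ((A * B).trace).re :=
  (Complex.le_def.1 (PosSemidef.trace_mul_nonneg_complex hA hB)).1

theorem trace_effect_mul_le {M ρ : Matrix d d ℂ} (hM : IsEffect M) (hρ : ρ.PosSemidef) :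
    ((M * ρ).trace).re ≤ (ρ.trace).re := by
  have h := PosSemidef.trace_mul_nonneg hM.2 hρ
  rw [Matrix.sub_mul, Matrix.one_mul, trace_sub, Complex.sub_re] at h
  linarith

theorem IsEffect.mul_self_le {M : Matrix d d ℂ} (hM : IsEffect M) : (M - M * M).PosSemidef := by
  have h1 := hM.2.mul_mul_conjTranspose_same M
  have h2 := hM.1.mul_mul_conjTranspose_same (1 - M)
  rw [hM.1.1.eq] at h1
  rw [hM.2.1.eq] at h2
  convert h1.add h2 using 1
  noncomm_ring

theorem isHermitian_posEigenProj (X : Matrix d d ℂ) : (posEigenProj X).IsHermitian :=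
  (cfc_predicate _ _ : IsSelfAdjoint (posEigenProj X))

theorem posEigenProj_mul_self (X : Matrix d d ℂ) :
    posEigenProj X * posEigenProj X = posEigenProj X := by
  rw [posEigenProj, ← cfc_mul _ _ _ (finite_real_spectrum.continuousOn _)
    (finite_real_spectrum.continuousOn _)]
  congr 1
  ext x
  split_ifs <;> simp

theorem isEffect_of_isHermitian_of_mul_self {P : Matrix d d ℂ} (h : P.IsHermitian)
    (h2 : P * P = P) : IsEffect P := by
  constructor
  · have := posSemidef_conjTranspose_mul_self P
    rwa [h.eq, h2] at this
  · have := posSemidef_conjTranspose_mul_self (1 - P)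
    have e : (1 - P)ᴴ * (1 - P) = 1 - P := by
      rw [conjTranspose_sub, conjTranspose_one, h.eq, Matrix.mul_sub, Matrix.sub_mul,
        Matrix.sub_mul, h2]
      simp
    rwa [e] at this

theorem isEffect_posEigenProj (X : Matrix d d ℂ) : IsEffect (posEigenProj X) :=
  isEffect_of_isHermitian_of_mul_self (isHermitian_posEigenProj X) (posEigenProj_mul_self X)

theorem posEigenProj_mul {X : Matrix d d ℂ} (hX : X.IsHermitian) : posEigenProj X * X = X⁺ := by
  have hX' : IsSelfAdjoint X := hX
  conv_lhs => rw [posEigenProj]; arg 2; rw [← cfc_id' ℝ X]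
  rw [← cfc_mul _ _ _ (finite_real_spectrum.continuousOn _)
    (finite_real_spectrum.continuousOn _), CFC.posPart_def, cfcₙ_eq_cfc]
  congr 1
  ext x
  split_ifs with h
  · simp [posPart_eq_self.2 h.le]
  · simp [posPart_eq_zero.2 (not_lt.1 h)]

theorem Orthogonal.posEigenProj_mul_sub {ρ σ : Matrix d d ℂ} (hρ : ρ.PosSemidef)
    (hσ : σ.PosSemidef) (h : Orthogonal ρ σ) : posEigenProj (ρ - σ) * (ρ - σ) = ρ := by
  rw [posEigenProj_mul (hρ.1.sub hσ.1)]
  exact (CFC.posPart_negPart_unique rfl h (nonneg_iff_posSemidef.2 hρ)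
    (nonneg_iff_posSemidef.2 hσ)).1

theorem Orthogonal.trace_posEigenProj {ρ σ : Matrix d d ℂ} (hρ : IsState ρ)
    (hσ : IsState σ) (h : Orthogonal ρ σ) :
    (posEigenProj (ρ - σ) * ρ).trace = 1 ∧ (posEigenProj (ρ - σ) * σ).trace = 0 := by
  have hP := isEffect_posEigenProj (ρ - σ)
  have h1 := trace_effect_mul_le hP hρ.1
  have h2 := PosSemidef.trace_mul_nonneg hP.1 hσ.1
  have h3 := congrArg (fun X : Matrix d d ℂ => (X.trace).re)
    (Orthogonal.posEigenProj_mul_sub hρ.1 hσ.1 h)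
  simp only [Matrix.mul_sub, trace_sub, Complex.sub_re, hρ.2, Complex.one_re] at h1 h3
  refine ⟨Complex.ext ?_ (Complex.le_def.1 (PosSemidef.trace_mul_nonneg_complex hP.1 hρ.1)).2.symm,
    Complex.ext ?_ (Complex.le_def.1 (PosSemidef.trace_mul_nonneg_complex hP.1 hσ.1)).2.symm⟩
  · rw [Complex.one_re]
    linarith
  · rw [Complex.zero_re]
    linarith

end Spectral

section TensorPower

theorem tensorPower_conjTranspose {d : Type*} (A : Matrix d d ℂ) (n : ℕ) :
    tensorPower Aᴴ n = (tensorPower A n)ᴴ := by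
  ext x y
  simp [tensorPower]

theorem tensorPower_diagonal {d : Type*} [DecidableEq d] (a : d → ℂ) (n : ℕ) :
    tensorPower (diagonal a) n = diagonal fun x => ∏ i, a (x i) := by
  ext x y
  simp only [tensorPower, of_apply, diagonal_apply]
  split_ifs with h
  · simp [h]
  · obtain ⟨i, hi⟩ := Function.ne_iff.1 h
    exact Finset.prod_eq_zero (Finset.mem_univ i) (if_neg hi)

variable {d : Type*} [Fintype d]

theorem tensorPower_mul (A B : Matrix d d ℂ) (n : ℕ) :
    tensorPower (A * B) n = tensorPower A n * tensorPower B n := by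
  classical
  ext x y
  simp only [tensorPower, of_apply, mul_apply, ← Finset.prod_mul_distrib]
  rw [Finset.prod_univ_sum, Fintype.piFinset_univ]

theorem trace_tensorPower (A : Matrix d d ℂ) (n : ℕ) :
    (tensorPower A n).trace = A.trace ^ n := by
  simp only [Matrix.trace, diag_apply, tensorPower, of_apply, Fintype.sum_pow]

theorem PosSemidef.tensorPower {A : Matrix d d ℂ} (hA : A.PosSemidef) (n : ℕ) :
    (tensorPower A n).PosSemidef := by
  classical
  obtain ⟨C, rfl⟩ := PosSemidef.exists_conjTranspose_mul_self hA
  rw [tensorPower_mul, tensorPower_conjTranspose]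
  exact posSemidef_conjTranspose_mul_self _

theorem IsState.tensorPower {ρ : Matrix d d ℂ} (h : IsState ρ) (n : ℕ) :
    IsState (tensorPower ρ n) :=
  ⟨PosSemidef.tensorPower h.1 n, by rw [trace_tensorPower, h.2, one_pow]⟩

end TensorPower

section ErrorProb

variable {d : Type*} [Fintype d] [DecidableEq d]

theorem errorProb_le {ρ σ M₁ M₂ : Matrix d d ℂ} {p q : ℝ} (hρ : ρ.PosSemidef)
    (hσ : σ.PosSemidef) (hp : 0 ≤ p) (hq : 0 ≤ q) (h₁ : M₁.PosSemidef) (h₂ : M₂.PosSemidef)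
    (h : M₁ + M₂ = 1) :
    errorProb ρ σ p q ≤ p * ((M₂ * ρ).trace).re + q * ((M₁ * σ).trace).re := by
  refine csInf_le ⟨0, ?_⟩ ⟨M₁, M₂, h₁, h₂, h, rfl⟩
  rintro _ ⟨N₁, N₂, hN₁, hN₂, -, rfl⟩
  have := PosSemidef.trace_mul_nonneg hN₂ hρ
  have := PosSemidef.trace_mul_nonneg hN₁ hσ
  positivity

theorem le_errorProb {ρ σ : Matrix d d ℂ} {p q r : ℝ}
    (h : ∀ M : Matrix d d ℂ, IsEffect M →
      r ≤ p * ((M * ρ).trace).re + q * (((1 - M) * σ).trace).re) :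
    r ≤ errorProb ρ σ p q := by
  refine le_csInf ⟨_, 1, 0, PosSemidef.one, PosSemidef.zero, add_zero 1, rfl⟩ ?_
  rintro _ ⟨M₁, M₂, h₁, h₂, hM, rfl⟩
  obtain rfl : M₁ = 1 - M₂ := eq_sub_of_add_eq hM
  exact h M₂ ⟨h₂, h₁⟩

/-- Bhattacharyya bound for commuting states, given by diagonal matrices. -/
theorem errorProb_diagonal_le (a b : d → ℝ) (ha : ∀ i, 0 ≤ a i) (hb : ∀ i, 0 ≤ b i) {p q : ℝ}
    (hp : 0 ≤ p) (hq : 0 ≤ q) (hp1 : p ≤ 1) (hq1 : q ≤ 1) :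
    errorProb (diagonal fun i => (a i : ℂ)) (diagonal fun i => (b i : ℂ)) p q ≤
      ∑ i, √(a i * b i) := by
  have hD : ∀ c : d → ℝ, (∀ i, 0 ≤ c i) → (diagonal fun i => (c i : ℂ)).PosSemidef :=
    fun c hc => posSemidef_diagonal_iff.2 fun i => by exact_mod_cast hc i
  let m : d → ℝ := fun i => if a i ≤ b i then 1 else 0
  have hm : ∀ i, m i = 0 ∨ m i = 1 := fun i => by simp only [m]; split_ifs <;> simp
  have hm0 : ∀ i, 0 ≤ m i := fun i => by rcases hm i with h | h <;> simp [h]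
  have hm1 : ∀ i, 0 ≤ 1 - m i := fun i => by rcases hm i with h | h <;> simp [h]
  refine (errorProb_le (M₁ := diagonal fun i => ((1 - m i : ℝ) : ℂ))
    (M₂ := diagonal fun i => (m i : ℂ)) (hD a ha) (hD b hb) hp hq (hD _ hm1) (hD _ hm0)
    ?_).trans ?_
  · rw [diagonal_add, ← diagonal_one]
    congr 1
    ext i
    simp
  · simp only [diagonal_mul_diagonal, trace_diagonal, ← Complex.ofReal_mul, Complex.re_sum,
      Complex.ofReal_re, Finset.mul_sum, ← Finset.sum_add_distrib]
    refine Finset.sum_le_sum fun i _ => ?_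
    simp only [m]
    split_ifs with h
    · have : a i ≤ √(a i * b i) := Real.le_sqrt_of_sq_le (by nlinarith [ha i])
      nlinarith [ha i]
    · have : b i ≤ √(a i * b i) := Real.le_sqrt_of_sq_le (by nlinarith [hb i])
      nlinarith [hb i]

theorem errorProb_tensorPower_diagonal_le (a b : d → ℝ) (ha : ∀ i, 0 ≤ a i) (hb : ∀ i, 0 ≤ b i)
    {p q : ℝ} (hp : 0 ≤ p) (hq : 0 ≤ q) (hp1 : p ≤ 1) (hq1 : q ≤ 1) (n : ℕ) :
    errorProb (tensorPower (diagonal fun i => (a i : ℂ)) n)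
      (tensorPower (diagonal fun i => (b i : ℂ)) n) p q ≤ (∑ i, √(a i * b i)) ^ n := by
  simp only [tensorPower_diagonal, ← Complex.ofReal_prod]
  refine (errorProb_diagonal_le _ _ (fun x => Finset.prod_nonneg fun i _ => ha _)
    (fun x => Finset.prod_nonneg fun i _ => hb _) hp hq hp1 hq1).trans_eq ?_
  rw [Fintype.sum_pow]
  refine Finset.sum_congr rfl fun x _ => ?_
  rw [← Finset.prod_mul_distrib, Real.sqrt_eq_rpow,
    ← Real.finsetProd_rpow _ _ fun i _ => mul_nonneg (ha _) (hb _)]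
  simp only [Real.sqrt_eq_rpow]

end ErrorProb

section Contraction

theorem continuous_tensorPower {d : Type*} (n : ℕ) :
    Continuous fun A : Matrix d d ℂ => tensorPower A n := by
  unfold tensorPower
  refine continuous_matrix fun x y => ?_
  simp only [of_apply]
  fun_prop

variable {d : Type*} [Fintype d] [DecidableEq d]

/-- The `χ²`-divergence of `ρ` from a positive definite `σ` is at most `c ^ 2` if
`-c σ ≤ ρ - σ ≤ c σ`. -/
theorem trace_mul_inv_mul_le {Δ σ : Matrix d d ℂ} {c : ℝ} (hc : 0 < c) (hσ : σ.PosDef)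
    (hσ1 : σ.trace = 1) (hΔ : Δ.trace = 0) (h₁ : ((c : ℂ) • σ - Δ).PosSemidef)
    (h₂ : ((c : ℂ) • σ + Δ).PosSemidef) : ((Δ * σ⁻¹ * Δ).trace).re ≤ c ^ 2 := by
  have hu : IsUnit σ.det := (isUnit_iff_isUnit_det _).1 hσ.isUnit
  set A := (c : ℂ) • σ - Δ with hA
  set B := (c : ℂ) • σ + Δ with hB
  have hD : ((2 * c : ℝ) • σ).PosDef := hσ.smul (by positivity)
  have hAB : A + B = (2 * c : ℝ) • σ := by
    rw [hA, hB, ← Complex.coe_smul, Complex.ofReal_mul]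
    module
  have hblock : (fromBlocks A A Aᴴ ((2 * c : ℝ) • σ)).PosSemidef := by
    rw [← hAB, h₁.1.eq]
    have e1 : (fromBlocks A A A A).PosSemidef := by
      have := h₁.conjTranspose_mul_mul_same (fromCols (1 : Matrix d d ℂ) (1 : Matrix d d ℂ))
      rw [conjTranspose_fromCols_eq_fromRows_conjTranspose, fromRows_mul, fromRows_mul_fromCols]
        at this
      simpa using this
    have e2 : (fromBlocks (0 : Matrix d d ℂ) 0 0 B).PosSemidef := by
      have := h₂.conjTranspose_mul_mul_same (fromCols (0 : Matrix d d ℂ) (1 : Matrix d d ℂ))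
      rw [conjTranspose_fromCols_eq_fromRows_conjTranspose, fromRows_mul, fromRows_mul_fromCols]
        at this
      simpa using this
    simpa [fromBlocks_add] using e1.add e2
  have : Invertible ((2 * c : ℝ) • σ) := hD.isUnit.invertible
  have hS := (PosDef.fromBlocks₂₂ A A hD).1 hblock
  have hinv : ((2 * c : ℝ) • σ)⁻¹ = ((2 * c)⁻¹ : ℝ) • σ⁻¹ := by
    refine inv_eq_left_inv ?_
    rw [smul_mul_smul_comm, nonsing_inv_mul _ hu, inv_mul_cancel₀ (by positivity), one_smul]
  have ht := (Complex.le_def.1 hS.trace_nonneg).1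
  rw [hinv, h₁.1.eq] at ht
  have hexp : A * σ⁻¹ * A = (c ^ 2 : ℝ) • σ - (2 * c : ℝ) • Δ + Δ * σ⁻¹ * Δ := by
    rw [hA, Complex.coe_smul]
    simp only [Matrix.mul_sub, Matrix.sub_mul, Matrix.smul_mul, Matrix.mul_smul,
      mul_nonsing_inv _ hu, Matrix.one_mul, Matrix.mul_assoc, nonsing_inv_mul _ hu, Matrix.mul_one]
    module
  rw [Matrix.mul_smul, Matrix.smul_mul, hexp] at ht
  simp only [hA, trace_sub, trace_add, trace_smul, hσ1, hΔ, smul_zero, sub_zero, smul_eq_mul,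
    mul_one, Complex.zero_re, Complex.sub_re, Complex.ofReal_re, Complex.add_re,
    Complex.real_smul, Complex.mul_re, Complex.ofReal_im, zero_mul] at ht
  have h3 : (2 * c) * (2 * c)⁻¹ = 1 := mul_inv_cancel₀ (by positivity)
  have h4 := mul_nonneg (by positivity : 0 ≤ 2 * c) ht
  rw [mul_sub, ← mul_assoc, h3] at h4
  nlinarith

/-- If `ρ = G σ`, the biases of all effects on `ρ^{⊗ n}` and `σ^{⊗ n}` are controlled by the
`n`-th power of `Tr[G σ Gᴴ]`. -/
theorem neg_le_trace_effect_mul_sub {σ G : Matrix d d ℂ} (hσ : IsState σ)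
    (hG : (G * σ).trace = 1) {n : ℕ} {η : ℝ} (hη : 0 < η)
    (hGσ : ((G * σ * Gᴴ).trace ^ n).re ≤ 1 + η ^ 2) {M : Matrix (Fin n → d) (Fin n → d) ℂ}
    (hM : IsEffect M) :
    -η ≤ ((M * (tensorPower (G * σ) n - tensorPower σ n)).trace).re := by
  set S := tensorPower σ n
  set H := tensorPower G n with hHdef
  have hS : IsState S := hσ.tensorPower n
  have hHS : tensorPower (G * σ) n = H * S := tensorPower_mul G σ n
  have hHS1 : (H * S).trace = 1 := by rw [← hHS, trace_tensorPower, hG, one_pow]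
  have hSH1 : (S * Hᴴ).trace = 1 := by
    have := congrArg star hHS1
    rwa [← trace_conjTranspose, conjTranspose_mul, hS.1.1.eq, star_one] at this
  have hHSH : ((H * S * Hᴴ).trace).re ≤ 1 + η ^ 2 := by
    rwa [← hHS, hHdef, ← tensorPower_conjTranspose, ← tensorPower_mul, trace_tensorPower]
  have hMSM : ((M * S * M).trace).re ≤ 1 := by
    have h1 := PosSemidef.trace_mul_nonneg hM.mul_self_le hS.1
    have h2 := trace_effect_mul_le hM hS.1
    rw [hS.2, Complex.one_re] at h2
    rw [Matrix.sub_mul, trace_sub, Complex.sub_re, Matrix.mul_assoc] at h1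
    rw [trace_mul_comm]
    linarith
  set K := H - 1 with hK
  have hKS : H * S - S = K * S := by rw [hK, Matrix.sub_mul, Matrix.one_mul]
  have hKSK : ((K * S * Kᴴ).trace).re ≤ η ^ 2 := by
    have e : K * S * Kᴴ = H * S * Hᴴ - H * S - S * Hᴴ + S := by
      rw [hK, conjTranspose_sub, conjTranspose_one]
      noncomm_ring
    rw [e]
    simp only [trace_add, trace_sub, hHS1, hSH1, hS.2, Complex.add_re, Complex.sub_re,
      Complex.one_re]
    linarith
  have hpos := (Complex.le_def.1
    (hS.1.mul_mul_conjTranspose_same ((η : ℂ) • M + K)).trace_nonneg).1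
  have e : ((η : ℂ) • M + K) * S * ((η : ℂ) • M + K)ᴴ =
      ((η ^ 2 : ℝ) : ℂ) • (M * S * M) + (η : ℂ) • (K * S * M) + (η : ℂ) • (K * S * M)ᴴ
        + K * S * Kᴴ := by
    simp only [conjTranspose_add, conjTranspose_smul, hM.1.1.eq, Complex.star_def,
      Complex.conj_ofReal, Matrix.add_mul, Matrix.mul_add, Matrix.smul_mul, Matrix.mul_smul,
      conjTranspose_mul, hS.1.1.eq, smul_add, smul_smul, Matrix.mul_assoc, Complex.ofReal_mul, sq]
    abel
  rw [e] at hpos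
  simp only [trace_add, trace_smul, trace_conjTranspose, Complex.add_re, smul_eq_mul,
    Complex.re_ofReal_mul, Complex.star_def, Complex.conj_re, Complex.zero_re] at hpos
  rw [hHS, hKS, trace_mul_comm]
  have h5 : 0 ≤ η * (2 * η + 2 * ((K * S * M).trace).re) := by nlinarith [sq_nonneg η]
  have := nonneg_of_mul_nonneg_right h5 hη
  linarith

theorem neg_le_trace_effect_mul_sub_of_posDef {ρ σ : Matrix d d ℂ} {c : ℝ} (hc : 0 < c)
    (hρ : IsState ρ) (hσ : IsState σ) (hσ' : σ.PosDef)
    (h₁ : ((c : ℂ) • σ - (ρ - σ)).PosSemidef) (h₂ : ((c : ℂ) • σ + (ρ - σ)).PosSemidef)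
    {n : ℕ} {η : ℝ} (hη : 0 < η) (hn : (1 + c ^ 2) ^ n ≤ 1 + η ^ 2)
    {M : Matrix (Fin n → d) (Fin n → d) ℂ} (hM : IsEffect M) :
    -η ≤ ((M * (tensorPower ρ n - tensorPower σ n)).trace).re := by
  have hu : IsUnit σ.det := (isUnit_iff_isUnit_det _).1 hσ'.isUnit
  have hG : (1 + (ρ - σ) * σ⁻¹) * σ = ρ := by
    rw [Matrix.add_mul, Matrix.mul_assoc, nonsing_inv_mul _ hu]
    simp
  have hχ := trace_mul_inv_mul_le hc hσ' hσ.2 (by simp [hρ.2, hσ.2]) h₁ h₂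
  have hGσG : (1 + (ρ - σ) * σ⁻¹) * σ * (1 + (ρ - σ) * σ⁻¹)ᴴ =
      ρ + (ρ - σ) + (ρ - σ) * σ⁻¹ * (ρ - σ) := by
    have e : ρ * σ⁻¹ = 1 + (ρ - σ) * σ⁻¹ := by
      rw [Matrix.sub_mul, mul_nonsing_inv _ hu]; abel
    rw [hG, conjTranspose_add, conjTranspose_one, conjTranspose_mul,
      (hρ.1.1.sub hσ.1.1).eq, hσ'.1.inv.eq, Matrix.mul_add, ← Matrix.mul_assoc, e,
      Matrix.add_mul]
    simp only [Matrix.mul_one, Matrix.one_mul, add_assoc]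
  have hpsd : ((1 + (ρ - σ) * σ⁻¹) * σ * (1 + (ρ - σ) * σ⁻¹)ᴴ).PosSemidef :=
    hσ.1.mul_mul_conjTranspose_same _
  have ht := hpsd.trace_nonneg
  have key := neg_le_trace_effect_mul_sub (G := 1 + (ρ - σ) * σ⁻¹) hσ (by rw [hG, hρ.2]) (n := n)
    hη ?_ hM
  · rwa [hG] at key
  · obtain ⟨x, hx⟩ : ∃ x : ℝ,
        ((1 + (ρ - σ) * σ⁻¹) * σ * (1 + (ρ - σ) * σ⁻¹)ᴴ).trace = (x : ℂ) :=
      ⟨_, Complex.eq_re_of_ofReal_le ht⟩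
    rw [hx] at ht ⊢
    have hx0 : 0 ≤ x := by exact_mod_cast ht
    have hx1 : x ≤ 1 + c ^ 2 := by
      have := congrArg Complex.re hx
      rw [hGσG] at this
      simp only [trace_add, trace_sub, hρ.2, hσ.2, sub_self, add_zero, Complex.add_re,
        Complex.one_re, Complex.ofReal_re] at this
      linarith
    rw [← Complex.ofReal_pow, Complex.ofReal_re]
    exact (pow_le_pow_left₀ hx0 hx1 n).trans hn

theorem neg_le_trace_effect_mul_sub_of_isState {ρ σ : Matrix d d ℂ} {c : ℝ} (hc : 0 < c)
    (hρ : IsState ρ) (hσ : IsState σ)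
    (h₁ : ((c : ℂ) • σ - (ρ - σ)).PosSemidef) (h₂ : ((c : ℂ) • σ + (ρ - σ)).PosSemidef)
    {n : ℕ} {η : ℝ} (hη : 0 < η) (hn : (1 + c ^ 2) ^ n ≤ 1 + η ^ 2)
    {M : Matrix (Fin n → d) (Fin n → d) ℂ} (hM : IsEffect M) :
    -η ≤ ((M * (tensorPower ρ n - tensorPower σ n)).trace).re := by
  have hcard : (Fintype.card d : ℂ) ≠ 0 := by
    intro h0
    have : IsEmpty d := Fintype.card_eq_zero_iff.1 (by exact_mod_cast h0)
    have := hρ.2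
    simp [Matrix.trace] at this
  let mix : Matrix d d ℂ → ℝ → Matrix d d ℂ := fun X s =>
    (1 - s) • X + s • ((Fintype.card d : ℝ)⁻¹ • (1 : Matrix d d ℂ))
  have hcd : 0 < (Fintype.card d : ℝ) := by
    have : Fintype.card d ≠ 0 := by exact_mod_cast hcard
    positivity
  have hmixc : ∀ X, Continuous (mix X) := fun X => by
    simp only [mix]
    fun_prop
  have hI : ((Fintype.card d : ℝ)⁻¹ • (1 : Matrix d d ℂ)).PosDef :=
    PosDef.one.smul (inv_pos.2 hcd)
  have hItr : ((Fintype.card d : ℝ)⁻¹ • (1 : Matrix d d ℂ)).trace = 1 := by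
    rw [trace_smul, trace_one, Complex.real_smul]
    push_cast
    exact inv_mul_cancel₀ hcard
  have hmixs : ∀ X, IsState X → ∀ s ∈ Set.Ioo (0 : ℝ) 1, (mix X s).PosDef ∧ (mix X s).trace = 1 :=
    fun X hX s hs => ⟨PosDef.posSemidef_add (hX.1.smul (sub_nonneg.2 hs.2.le))
      (hI.smul hs.1), by
        simp only [mix, trace_add, trace_smul (1 - s), trace_smul s, hItr, hX.2]
        simp⟩
  have hev : ∀ᶠ s in 𝓝[>] (0 : ℝ),
      -η ≤ ((M * (tensorPower (mix ρ s) n - tensorPower (mix σ s) n)).trace).re := by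
    filter_upwards [Ioo_mem_nhdsGT (zero_lt_one' ℝ)] with s hs
    obtain ⟨hρs, hρs1⟩ := hmixs ρ hρ s hs
    obtain ⟨hσs, hσs1⟩ := hmixs σ hσ s hs
    refine neg_le_trace_effect_mul_sub_of_posDef hc ⟨hρs.posSemidef, hρs1⟩
      ⟨hσs.posSemidef, hσs1⟩ hσs ?_ ?_ hη hn hM
    · convert (h₁.smul (sub_nonneg.2 hs.2.le)).add
        ((hI.posSemidef.smul hs.1.le).smul hc.le) using 1
      simp only [mix, Complex.coe_smul]
      module
    · convert (h₂.smul (sub_nonneg.2 hs.2.le)).add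
        ((hI.posSemidef.smul hs.1.le).smul hc.le) using 1
      simp only [mix, Complex.coe_smul]
      module
  have hcont : Continuous fun s : ℝ =>
      ((M * (tensorPower (mix ρ s) n - tensorPower (mix σ s) n)).trace).re :=
    Complex.continuous_re.comp (Continuous.matrix_trace (continuous_const.matrix_mul
      (((continuous_tensorPower n).comp (hmixc ρ)).sub
        ((continuous_tensorPower n).comp (hmixc σ)))))
  have hlim := (hcont.tendsto 0).mono_left (nhdsWithin_le_nhds (s := Set.Ioi 0))
  have := ge_of_tendsto hlim hev
  simpa [mix] using this

theorem le_errorProb_tensorPower {ρ σ : Matrix d d ℂ} {c : ℝ} (hc : 0 < c)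
    (hρ : IsState ρ) (hσ : IsState σ)
    (h₁ : ((c : ℂ) • σ - (ρ - σ)).PosSemidef) (h₂ : ((c : ℂ) • σ + (ρ - σ)).PosSemidef)
    {n : ℕ} {η p q : ℝ} (hη : 0 < η) (hn : (1 + c ^ 2) ^ n ≤ 1 + η ^ 2) (hp : 0 ≤ p)
    (hp1 : p ≤ 1) :
    min p q - η ≤ errorProb (tensorPower ρ n) (tensorPower σ n) p q := by
  refine le_errorProb fun M hM => ?_
  have h := neg_le_trace_effect_mul_sub_of_isState hc hρ hσ h₁ h₂ hη hn hM
  have hS := hσ.tensorPower n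
  have h3 := PosSemidef.trace_mul_nonneg hM.1 hS.1
  have h4 := trace_effect_mul_le hM hS.1
  rw [hS.2, Complex.one_re] at h4
  simp only [Matrix.sub_mul, Matrix.one_mul, Matrix.mul_sub, trace_sub, Complex.sub_re, hS.2,
    Complex.one_re] at h ⊢
  set x := ((M * tensorPower σ n).trace).re
  set y := ((M * tensorPower ρ n).trace).re
  have h5 : p * (x - η) ≤ p * y := mul_le_mul_of_nonneg_left (by linarith) hp
  have h6 : min p q * x ≤ p * x := mul_le_mul_of_nonneg_right (min_le_left _ _) h3
  have h7 : min p q * (1 - x) ≤ q * (1 - x) :=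
    mul_le_mul_of_nonneg_right (min_le_right _ _) (by linarith)
  nlinarith

end Contraction

section Channels

variable {d e : Type*} [Fintype d] [Fintype e]

theorem IsChannel.isState {A : Matrix d d ℂ →ₗ[ℂ] Matrix e e ℂ} (hA : IsChannel A)
    {ρ : Matrix d d ℂ} (hρ : IsState ρ) : IsState (A ρ) := by
  refine ⟨?_, by rw [hA.2, hρ.2]⟩
  have := (hA.1 1 _ (hρ.1.submatrix Prod.snd)).submatrix fun j : e => ((0 : Fin 1), j)
  exact this

/-- A linear map with a Kraus decomposition is completely positive. -/
theorem ampliation_posSemidef_of_kraus {ι : Type*} [Fintype ι]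
    {A : Matrix d d ℂ →ₗ[ℂ] Matrix e e ℂ} (K : ι → Matrix e d ℂ)
    (hK : ∀ X, A X = ∑ i, K i * X * (K i)ᴴ) (k : ℕ)
    {X : Matrix (Fin k × d) (Fin k × d) ℂ} (hX : X.PosSemidef) :
    (ampliation k A X).PosSemidef := by
  let V : ι → Matrix (Fin k × e) (Fin k × d) ℂ := fun i =>
    of fun x y => if x.1 = y.1 then K i x.2 y.2 else 0
  have h : ampliation k A X = ∑ i, V i * X * (V i)ᴴ := by
    ext x y
    simp only [ampliation, of_apply, hK, Matrix.sum_apply, mul_apply, conjTranspose_apply, V,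
      Fintype.sum_prod_type, ite_mul, zero_mul, apply_ite star, star_zero, mul_ite, mul_zero]
    simp [Finset.sum_ite_irrel]
  rw [h]
  exact posSemidef_sum _ fun i _ => hX.mul_mul_conjTranspose_same _

/-- A measurement with effects `N i`, viewed as a map to diagonal matrices, is a channel. -/
theorem isChannel_of_eq_diagonal [DecidableEq d] [DecidableEq e]
    {A : Matrix d d ℂ →ₗ[ℂ] Matrix e e ℂ} (N : e → Matrix d d ℂ) (hN : ∀ i, (N i).PosSemidef)
    (hN1 : ∑ i, N i = 1) (hA : ∀ X, A X = diagonal fun i => (N i * X).trace) : IsChannel A := by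
  constructor
  · choose B hB using fun i => PosSemidef.exists_conjTranspose_mul_self (hN i)
    intro k X hX
    refine ampliation_posSemidef_of_kraus (ι := e × d)
      (fun s => of fun j x => if s.1 = j then B s.1 s.2 x else 0) (fun Y => ?_) k hX
    ext x y
    simp only [hA, diagonal_apply, Matrix.sum_apply, mul_apply, of_apply, conjTranspose_apply,
      Fintype.sum_prod_type, ite_mul, zero_mul, apply_ite star, star_zero, mul_ite, mul_zero]
    have hinner : ∀ i l : _, (∑ v, if i = y then (∑ u, if i = x then B i l u * Y u v else 0) *
        star (B i l v) else 0) = if i = y then (if i = x then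
          ∑ v, (∑ u, B i l u * Y u v) * star (B i l v) else 0) else 0 := by
      intro i l
      split_ifs <;> simp
    simp only [hinner]
    simp only [Finset.sum_ite_irrel, Finset.sum_const_zero, Finset.sum_ite_eq', Finset.mem_univ,
      if_true]
    by_cases hxy : x = y
    · subst hxy
      simp only [if_true]
      rw [hB x, Matrix.mul_assoc, trace_mul_comm]
      simp only [Matrix.trace, diag_apply, mul_apply, conjTranspose_apply]
    · rw [if_neg hxy, if_neg (Ne.symm hxy)]
  · intro X
    rw [hA, trace_diagonal, ← trace_sum, ← Finset.sum_mul, hN1, Matrix.one_mul]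

theorem posSemidef_of_trace_effect_nonneg [DecidableEq d] {X : Matrix d d ℂ} (hX : X.IsHermitian)
    (h : ∀ M, IsEffect M → 0 ≤ ((M * X).trace).re) : X.PosSemidef := by
  have h1 := h _ (isEffect_posEigenProj (-X))
  have h2 := posEigenProj_mul hX.neg
  have h3 : ((-X)⁺).PosSemidef := nonneg_iff_posSemidef.1 (CFC.posPart_nonneg _)
  have h4 := h3.trace_nonneg
  have h5 : ((-X)⁺).trace = 0 := by
    have e : ((-X)⁺).trace.re = 0 := by
      rw [← h2] at h4 ⊢
      rw [Matrix.mul_neg, trace_neg] at h4 ⊢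
      have := (Complex.le_def.1 h4).1
      rw [Complex.neg_re, Complex.zero_re] at this
      rw [Complex.neg_re]
      linarith
    exact Complex.ext e (Complex.le_def.1 h4).2.symm
  have h6 := h3.trace_eq_zero_iff.1 h5
  have h7 : 0 ≤ X := by
    have := CFC.posPart_sub_negPart (-X) hX.neg
    rw [h6, zero_sub, neg_inj] at this
    rw [← this]
    exact CFC.negPart_nonneg _
  exact nonneg_iff_posSemidef.1 h7

theorem IsQLDP.posSemidef_sub [DecidableEq e] {ε : ℝ} {A : Matrix d d ℂ →ₗ[ℂ] Matrix e e ℂ}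
    (hA : IsChannel A) (h : IsQLDP ε A) {ρ σ : Matrix d d ℂ} (hρ : IsState ρ) (hσ : IsState σ) :
    (Real.exp ε • A σ - A ρ).PosSemidef := by
  have hρ' := IsChannel.isState hA hρ
  have hσ' := IsChannel.isState hA hσ
  refine posSemidef_of_trace_effect_nonneg
    ((hσ'.1.smul (Real.exp_pos ε).le).1.sub hρ'.1.1) fun M hM => ?_
  have := h ρ σ hρ hσ M hM
  rw [Matrix.mul_sub, Matrix.mul_smul, trace_sub, trace_smul, Complex.sub_re, Complex.smul_re,
    smul_eq_mul]
  linarith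

theorem IsQLDP.le_errorProb [DecidableEq e] {ε : ℝ} (hε : 0 < ε)
    {A : Matrix d d ℂ →ₗ[ℂ] Matrix e e ℂ} (hA : IsChannel A) (h : IsQLDP ε A)
    {ρ σ : Matrix d d ℂ} (hρ : IsState ρ) (hσ : IsState σ) {n : ℕ} {η p q : ℝ} (hη : 0 < η)
    (hn : n * (Real.exp ε - 1) ^ 2 ≤ Real.log (1 + η ^ 2)) (hp : 0 ≤ p) (hp1 : p ≤ 1) :
    min p q - η ≤ errorProb (tensorPower (A ρ) n) (tensorPower (A σ) n) p q := by
  have hρ' := IsChannel.isState hA hρ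
  have hσ' := IsChannel.isState hA hσ
  have hx : 1 < Real.exp ε := Real.one_lt_exp_iff.2 hε
  have h₁ := h.posSemidef_sub hA hρ hσ
  have h₂ := h.posSemidef_sub hA hσ hρ
  have hc : 0 < Real.exp ε - 1 := sub_pos.2 hx
  refine le_errorProb_tensorPower hc hρ' hσ' ?_ ?_ hη ?_ hp hp1
  · convert h₁ using 1
    rw [Complex.coe_smul]
    module
  · have hx' : 0 ≤ (Real.exp ε)⁻¹ := (inv_pos.2 (by positivity)).le
    have hx2 : 0 ≤ Real.exp ε - 2 + (Real.exp ε)⁻¹ := by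
      have e : Real.exp ε - 2 + (Real.exp ε)⁻¹ = (Real.exp ε - 1) ^ 2 * (Real.exp ε)⁻¹ := by
        field_simp
        ring
      rw [e]
      positivity
    convert (h₂.smul hx').add (hσ'.1.smul hx2) using 1
    rw [Complex.coe_smul, smul_sub, smul_smul, inv_mul_cancel₀ (by positivity)]
    module
  · calc (1 + (Real.exp ε - 1) ^ 2) ^ n ≤ Real.exp ((Real.exp ε - 1) ^ 2) ^ n :=
        pow_le_pow_left₀ (by positivity) (by linarith [Real.add_one_le_exp ((Real.exp ε - 1) ^ 2)]) n
      _ = Real.exp (n * (Real.exp ε - 1) ^ 2) := (Real.exp_nat_mul _ _).symm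
      _ ≤ 1 + η ^ 2 := (Real.le_log_iff_exp_le (by positivity)).1 hn

end Channels

section Mechanism

variable {d : Type*} [Fintype d] [DecidableEq d]

/-- The effects of the measure-then-depolarize mechanism. -/
def mechanismEffect (u : ℝ) (P : Matrix d d ℂ) : Fin 2 → Matrix d d ℂ :=
  ![(1 - u) • P + u • (1 - P), u • P + (1 - u) • (1 - P)]

theorem measureDepolarize_apply {ε u : ℝ} (hu : u = (Real.exp ε + 1)⁻¹) (ρ σ X : Matrix d d ℂ) :
    measureDepolarize ε ρ σ X =
      diagonal fun i => (mechanismEffect u (posEigenProj (ρ - σ)) i * X).trace := by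
  have h2 : 2 / (Real.exp ε + 1) = 2 * u := by rw [hu]; rfl
  ext i j
  fin_cases i <;> fin_cases j <;>
    simp [measureDepolarize, depolarizing, measurementChannel, mechanismEffect, h2,
      Matrix.add_mul, Matrix.sub_mul, Fin.sum_univ_two] <;> ring

theorem trace_mechanismEffect_mem {u : ℝ} (hu1 : u ≤ 1 / 2) {P X : Matrix d d ℂ}
    (hP : IsEffect P) (hX : IsState X) (i : Fin 2) :
    ((mechanismEffect u P i * X).trace).re ∈ Set.Icc u (1 - u) := by
  have h0 := PosSemidef.trace_mul_nonneg hP.1 hX.1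
  have h1 := trace_effect_mul_le hP hX.1
  rw [hX.2, Complex.one_re] at h1
  fin_cases i <;>
    simp only [mechanismEffect, Fin.zero_eta, Fin.mk_one, cons_val_zero, cons_val_one,
      Matrix.add_mul, Matrix.sub_mul, Matrix.smul_mul, Matrix.one_mul, trace_add, trace_sub,
      trace_smul, Complex.add_re, Complex.sub_re, Complex.smul_re, smul_eq_mul, hX.2,
      Complex.one_re, Set.mem_Icc] <;> constructor <;> nlinarith

theorem isChannel_measureDepolarize {ε : ℝ} (ρ σ : Matrix d d ℂ) :
    IsChannel (measureDepolarize ε ρ σ) := by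
  have hP := isEffect_posEigenProj (ρ - σ)
  have hu0 : 0 ≤ (Real.exp ε + 1)⁻¹ := by positivity
  have hu1 : 0 ≤ 1 - (Real.exp ε + 1)⁻¹ :=
    sub_nonneg.2 (inv_le_one_of_one_le₀ (by linarith [Real.exp_pos ε]))
  refine isChannel_of_eq_diagonal _ (fun i => ?_) ?_ (measureDepolarize_apply rfl ρ σ)
  · fin_cases i
    · exact (hP.1.smul hu1).add (hP.2.smul hu0)
    · exact (hP.1.smul hu0).add (hP.2.smul hu1)
  · simp only [mechanismEffect, Fin.sum_univ_two, cons_val_zero, cons_val_one]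
    module

theorem isQLDP_measureDepolarize {ε : ℝ} (hε : 0 < ε) (ρ σ : Matrix d d ℂ) :
    IsQLDP ε (measureDepolarize ε ρ σ) := by
  intro ω τ hω hτ M hM
  have hx : 1 < Real.exp ε := Real.one_lt_exp_iff.2 hε
  set u := (Real.exp ε + 1)⁻¹ with hu
  have hu2 : u * (Real.exp ε + 1) = 1 := inv_mul_cancel₀ (by positivity)
  have hu0 : 0 < u := by positivity
  have hu1 : u ≤ 1 / 2 := by nlinarith
  have hP := isEffect_posEigenProj (ρ - σ)
  rw [measureDepolarize_apply hu, measureDepolarize_apply hu]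
  have htr : ∀ t : Fin 2 → ℂ, ((M * diagonal t).trace).re = ∑ i, (M i i).re * (t i).re := by
    intro t
    have : (M * diagonal t).trace = ∑ i, M i i * t i := by
      simp only [Matrix.trace, diag_apply, mul_diagonal]
    rw [this, Complex.re_sum]
    refine Finset.sum_congr rfl fun i _ => ?_
    rw [Complex.mul_re, ← (Complex.le_def.1 (hM.1.diag_nonneg (i := i))).2, Complex.zero_im,
      zero_mul, sub_zero]
  rw [htr, htr, Finset.mul_sum]
  refine Finset.sum_le_sum fun i _ => ?_
  have hMi := Complex.le_def.1 (hM.1.diag_nonneg (i := i))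
  have h1 := (trace_mechanismEffect_mem hu1 hP hω i).2
  have h2 := (trace_mechanismEffect_mem hu1 hP hτ i).1
  rw [mul_left_comm]
  refine mul_le_mul_of_nonneg_left ?_ hMi.1
  nlinarith

theorem measureDepolarize_apply_of_orthogonal {ε u : ℝ} (hu : u = (Real.exp ε + 1)⁻¹)
    {ρ σ : Matrix d d ℂ} (hρ : IsState ρ) (hσ : IsState σ) (h : Orthogonal ρ σ) :
    measureDepolarize ε ρ σ ρ = diagonal (fun i => ((![1 - u, u] i : ℝ) : ℂ)) ∧
    measureDepolarize ε ρ σ σ = diagonal fun i => ((![u, 1 - u] i : ℝ) : ℂ) := by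
  obtain ⟨h1, h2⟩ := h.trace_posEigenProj hρ hσ
  constructor <;> rw [measureDepolarize_apply hu] <;> congr 1 <;> ext i <;> fin_cases i <;>
    simp [mechanismEffect, Matrix.add_mul, Matrix.sub_mul, h1, h2, hρ.2, hσ.2]

theorem errorProb_measureDepolarize_le {ε : ℝ} (hε : 0 < ε) {ρ σ : Matrix d d ℂ}
    (hρ : IsState ρ) (hσ : IsState σ) (h : Orthogonal ρ σ) {p q : ℝ}
    (hp : 0 ≤ p) (hq : 0 ≤ q) (hp1 : p ≤ 1) (hq1 : q ≤ 1) (n : ℕ) :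
    errorProb (tensorPower (measureDepolarize ε ρ σ ρ) n)
      (tensorPower (measureDepolarize ε ρ σ σ) n) p q ≤
      Real.exp (-(n * ((Real.exp ε - 1) / (Real.exp ε + 1)) ^ 2 / 2)) := by
  have hx : 1 < Real.exp ε := Real.one_lt_exp_iff.2 hε
  obtain ⟨u, hu⟩ : ∃ u, u = (Real.exp ε + 1)⁻¹ := ⟨_, rfl⟩
  have hu2 : u * (Real.exp ε + 1) = 1 := hu ▸ inv_mul_cancel₀ (by positivity)
  have hu0 : 0 < u := hu ▸ by positivity
  have hu1 : u ≤ 1 / 2 := by nlinarith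
  obtain ⟨e1, e2⟩ := measureDepolarize_apply_of_orthogonal hu hρ hσ h
  rw [e1, e2]
  refine (errorProb_tensorPower_diagonal_le _ _ ?_ ?_ hp hq hp1 hq1 n).trans ?_
  · intro i; fin_cases i <;> simp <;> linarith
  · intro i; fin_cases i <;> simp <;> linarith
  · have hr : (Real.exp ε - 1) / (Real.exp ε + 1) = 1 - 2 * u := by
      rw [div_eq_mul_inv, ← hu]; linarith
    rw [hr, show -(n * (1 - 2 * u) ^ 2 / 2) = n * (-((1 - 2 * u) ^ 2 / 2)) by ring, Real.exp_nat_mul]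
    refine pow_le_pow_left₀ (Finset.sum_nonneg fun i _ => Real.sqrt_nonneg _) ?_ n
    have hs : √(u * (1 - u)) ≤ Real.exp (-((1 - 2 * u) ^ 2 / 2)) / 2 := by
      refine Real.sqrt_le_iff.2 ⟨by positivity, ?_⟩
      rw [div_pow, ← Real.exp_nat_mul]
      have := Real.add_one_le_exp (-(1 - 2 * u) ^ 2)
      rw [show ((2 : ℕ) : ℝ) * -((1 - 2 * u) ^ 2 / 2) = -(1 - 2 * u) ^ 2 by push_cast; ring]
      nlinarith
    rw [Fin.sum_univ_two]
    simp only [cons_val_zero, cons_val_one]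
    rw [mul_comm (1 - u) u]
    linarith

end Mechanism

section SampleComplexity

theorem ratio_sq_bounds {ε : ℝ} (hε : 0 < ε) (hε1 : ε < 1) :
    1 / ε ^ 2 ≤ ((Real.exp ε + 1) / (Real.exp ε - 1)) ^ 2 ∧
      ((Real.exp ε + 1) / (Real.exp ε - 1)) ^ 2 ≤ 16 * (1 / ε ^ 2) := by
  have h1 := Real.add_one_le_exp ε
  have h2 : Real.exp ε - 1 ≤ 2 * ε := by
    have := Real.abs_exp_sub_one_le (x := ε) (by rw [abs_of_pos hε]; exact hε1.le)
    rw [abs_of_pos hε] at this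
    exact (le_abs_self _).trans this
  have h3 : 0 < Real.exp ε - 1 := by linarith
  constructor
  · rw [← _root_.one_div_pow]
    refine pow_le_pow_left₀ (by positivity) ?_ 2
    rw [div_le_div_iff₀ hε h3]
    nlinarith
  · rw [show 16 * (1 / ε ^ 2) = (4 / ε) ^ 2 by ring]
    refine pow_le_pow_left₀ (by positivity) ?_ 2
    rw [div_le_div_iff₀ h3 hε]
    nlinarith

variable {d : Type*} [Fintype d]

theorem le_of_privateSampleComplexity_eq {ε : ℝ} {ρ σ : Matrix d d ℂ} {α p q L : ℝ} {n : ℕ}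
    (h : ∀ (m : ℕ) (A : Matrix d d ℂ →ₗ[ℂ] Matrix (Fin m) (Fin m) ℂ), IsChannel A → IsQLDP ε A →
      ∀ k : ℕ, errorProb (tensorPower (A ρ) k) (tensorPower (A σ) k) p q ≤ α → L ≤ k)
    (hn : privateSampleComplexity ε ρ σ α p q = n) : L ≤ n := by
  have : ((⌈L⌉₊ : ℕ) : ℕ∞) ≤ privateSampleComplexity ε ρ σ α p q :=
    le_iInf fun m => le_iInf fun A => le_iInf fun hA => le_iInf fun hA' => le_iInf fun k =>
      le_iInf fun hk => Nat.cast_le.2 (Nat.ceil_le.2 (h m A hA hA' k hk))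
  rw [hn, Nat.cast_le] at this
  exact Nat.ceil_le.1 this

theorem lower_bound_of_errorProb_le {ε : ℝ} (hε : 0 < ε) {e : Type*} [Fintype e] [DecidableEq e]
    {A : Matrix d d ℂ →ₗ[ℂ] Matrix e e ℂ} (hA : IsChannel A) (h : IsQLDP ε A)
    {ρ σ : Matrix d d ℂ} (hρ : IsState ρ) (hσ : IsState σ) {n : ℕ} {η p q α : ℝ} (hη : 0 < η)
    (hp : 0 ≤ p) (hp1 : p ≤ 1) (hα : α < min p q - η)
    (hn : errorProb (tensorPower (A ρ) n) (tensorPower (A σ) n) p q ≤ α) :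
    min (Real.log (1 + η ^ 2) / 16) (1 / 4) * ((Real.exp ε + 1) / (Real.exp ε - 1)) ^ 2 ≤ n := by
  have hx : 1 < Real.exp ε := Real.one_lt_exp_iff.2 hε
  have hδ : 0 < Real.log (1 + η ^ 2) := Real.log_pos (by nlinarith)
  have hlt : Real.log (1 + η ^ 2) < n * (Real.exp ε - 1) ^ 2 := by
    by_contra! hle
    linarith [h.le_errorProb (q := q) hε hA hρ hσ hη hle hp hp1]
  have hn1 : (1 : ℝ) ≤ n := by
    rcases Nat.eq_zero_or_pos n with rfl | h0
    · simp at hlt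
      linarith
    · exact_mod_cast h0
  set x := Real.exp ε
  have hx0 : 0 < (x - 1) ^ 2 := pow_pos (sub_pos.2 hx) 2
  rw [div_pow, ← mul_div_assoc, div_le_iff₀ hx0]
  rcases le_total x 3 with h3 | h3
  · have h16 : (x + 1) ^ 2 ≤ 16 := by nlinarith
    have := mul_le_mul (min_le_left (Real.log (1 + η ^ 2) / 16) (1 / 4)) h16 (by positivity)
      (by positivity)
    linarith
  · have h4 : (x + 1) ^ 2 ≤ 4 * (x - 1) ^ 2 := by nlinarith
    have := mul_le_mul (min_le_right (Real.log (1 + η ^ 2) / 16) (1 / 4)) h4 (by positivity)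
      (by positivity)
    nlinarith

variable [DecidableEq d]

theorem exists_sampleComplexity_measureDepolarize {ε : ℝ} (hε : 0 < ε) {ρ σ : Matrix d d ℂ}
    (hρ : IsState ρ) (hσ : IsState σ) (h : Orthogonal ρ σ) {p q α : ℝ}
    (hp : 0 ≤ p) (hq : 0 ≤ q) (hp1 : p ≤ 1) (hq1 : q ≤ 1) (hα : 0 < α) (hα1 : α ≤ 1) :
    ∃ m : ℕ, sampleComplexity (measureDepolarize ε ρ σ ρ) (measureDepolarize ε ρ σ σ) α p q = m ∧
      (m : ℝ) ≤ (1 - 2 * Real.log α) * ((Real.exp ε + 1) / (Real.exp ε - 1)) ^ 2 := by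
  have hx : 1 < Real.exp ε := Real.one_lt_exp_iff.2 hε
  have hL : Real.log α ≤ 0 := Real.log_nonpos hα.le hα1
  have hinv : ((Real.exp ε - 1) / (Real.exp ε + 1)) ^ 2 =
      (((Real.exp ε + 1) / (Real.exp ε - 1)) ^ 2)⁻¹ := by rw [← inv_pow, inv_div]
  have hR : 1 ≤ ((Real.exp ε + 1) / (Real.exp ε - 1)) ^ 2 :=
    one_le_pow₀ ((one_le_div (sub_pos.2 hx)).2 (by linarith))
  have herr := errorProb_measureDepolarize_le hε hρ hσ h hp hq hp1 hq1
  rw [hinv] at herr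
  set R := ((Real.exp ε + 1) / (Real.exp ε - 1)) ^ 2
  set k := ⌈-2 * Real.log α * R⌉₊
  have hk1 : -2 * Real.log α * R ≤ k := Nat.le_ceil _
  have hk2 : (k : ℝ) < -2 * Real.log α * R + 1 :=
    Nat.ceil_lt_add_one (mul_nonneg (by linarith) (by linarith))
  have hle : sampleComplexity (measureDepolarize ε ρ σ ρ) (measureDepolarize ε ρ σ σ) α p q ≤ k := by
    refine iInf₂_le k ((herr k).trans ?_)
    rw [← Real.le_log_iff_exp_le hα]
    have : -2 * Real.log α ≤ k * R⁻¹ := by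
      rw [← div_eq_mul_inv, le_div_iff₀ (by linarith)]
      exact hk1
    linarith
  obtain ⟨m, hm⟩ := ENat.ne_top_iff_exists.1 (ne_top_of_le_ne_top (ENat.natCast_ne_top k) hle)
  refine ⟨m, hm.symm, ?_⟩
  rw [← hm, Nat.cast_le] at hle
  have : (m : ℝ) ≤ k := by exact_mod_cast hle
  linarith

end SampleComplexity

end QPriv

end

theorem mainTheorem7 (α p q : ℝ) (hp : 0 < p) (hq : 0 < q) (hpq : p + q = 1)
    (hα : 0 < α) (hαpq : α ≤ p * q) :
    ∃ c C : ℝ, 0 < c ∧ 0 < C ∧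
      ∀ (d : Type*) [Fintype d] [DecidableEq d] (ρ σ : Matrix d d ℂ),
        QPriv.IsState ρ → QPriv.IsState σ → QPriv.Orthogonal ρ σ →
        ∀ ε : ℝ, 0 < ε →
          QPriv.IsChannel (QPriv.measureDepolarize ε ρ σ) ∧
          QPriv.IsQLDP ε (QPriv.measureDepolarize ε ρ σ) ∧
          ∃ n m : ℕ,
            QPriv.privateSampleComplexity ε ρ σ α p q = (n : ℕ∞) ∧
            QPriv.sampleComplexity (QPriv.measureDepolarize ε ρ σ ρ)
              (QPriv.measureDepolarize ε ρ σ σ) α p q = (m : ℕ∞) ∧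
            (c * ((Real.exp ε + 1) / (Real.exp ε - 1)) ^ 2 ≤ (n : ℝ) ∧
              (n : ℝ) ≤ C * ((Real.exp ε + 1) / (Real.exp ε - 1)) ^ 2) ∧
            (ε < 1 → c * (1 / ε ^ 2) ≤ (n : ℝ) ∧ (n : ℝ) ≤ C * (1 / ε ^ 2)) ∧
            (m : ℝ) ≤ C * (n : ℝ) := by
  have hmin : 0 < min p q := lt_min hp hq
  obtain ⟨η, hη, hαη⟩ : ∃ η : ℝ, 0 < η ∧ α < min p q - η := by
    refine ⟨min p q ^ 2 / 2, by positivity, ?_⟩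
    rcases min_choice p q with h | h <;> rw [h] <;> nlinarith
  have hα1 : α ≤ 1 := by nlinarith
  have hL : Real.log α ≤ 0 := Real.log_nonpos hα.le hα1
  set c := min (Real.log (1 + η ^ 2) / 16) (1 / 4)
  have hδ : 0 < Real.log (1 + η ^ 2) := Real.log_pos (by nlinarith)
  have hc0 : 0 < c := lt_min (by positivity) (by norm_num)
  set C₁ := 1 - 2 * Real.log α with hC₁
  have hC₁0 : 0 < C₁ := by linarith
  refine ⟨c, max (16 * C₁) (C₁ / c), hc0, lt_max_of_lt_left (by positivity), ?_⟩
  intro d _ _ ρ σ hρ hσ horth ε hε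
  have hch := QPriv.isChannel_measureDepolarize (ε := ε) ρ σ
  have hld := QPriv.isQLDP_measureDepolarize hε ρ σ
  obtain ⟨m, hm, hmle⟩ := QPriv.exists_sampleComplexity_measureDepolarize hε hρ hσ horth hp.le hq.le
    (by linarith) (by linarith) hα hα1
  have hnm : QPriv.privateSampleComplexity ε ρ σ α p q ≤ m :=
    hm ▸ iInf_le_of_le 2 (iInf_le_of_le _ (iInf₂_le hch hld))
  obtain ⟨n, hn⟩ := ENat.ne_top_iff_exists.1 (ne_top_of_le_ne_top (ENat.natCast_ne_top m) hnm)
  have hlow : c * ((Real.exp ε + 1) / (Real.exp ε - 1)) ^ 2 ≤ n :=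
    QPriv.le_of_privateSampleComplexity_eq (fun _ A hA hA' k hk =>
      QPriv.lower_bound_of_errorProb_le hε hA hA' hρ hσ hη hp.le (by linarith) hαη hk) hn.symm
  have hnm' : (n : ℝ) ≤ m := by
    rw [← hn, Nat.cast_le] at hnm
    exact_mod_cast hnm
  refine ⟨hch, hld, n, m, hn.symm, hm, ⟨hlow, ?_⟩, fun hε1 => ?_, ?_⟩
  · refine (hnm'.trans hmle).trans (mul_le_mul_of_nonneg_right ?_ (sq_nonneg _))
    exact le_max_of_le_left (by linarith)
  · obtain ⟨h1, h2⟩ := QPriv.ratio_sq_bounds hε hε1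
    refine ⟨(mul_le_mul_of_nonneg_left h1 hc0.le).trans hlow, (hnm'.trans hmle).trans ?_⟩
    refine (mul_le_mul_of_nonneg_left h2 hC₁0.le).trans ?_
    rw [← mul_assoc, mul_comm C₁]
    exact mul_le_mul_of_nonneg_right (le_max_left _ _) (by positivity)
  · refine hmle.trans ?_
    have h3 : C₁ / c * (c * ((Real.exp ε + 1) / (Real.exp ε - 1)) ^ 2) ≤ C₁ / c * n :=
      mul_le_mul_of_nonneg_left hlow (by positivity)
    rw [← mul_assoc, div_mul_cancel₀ _ hc0.ne'] at h3
    exact h3.trans (mul_le_mul_of_nonneg_right (le_max_right _ _) (Nat.cast_nonneg n))
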